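/- Conventions. For a finite rooted tree $T=T(r)$ (a finite connected acyclic graph with a distinguished vertex $r$) and a vertex $v$ of $T$, a vertex $u\neq v$ is a successor of $v$ if $v$ lies on the path joining $r$ and $u$; it is a direct successor (child) of $v$ if moreover $u$ and $v$ are adjacent. $\delta^+(v)$ is the number of children of $v$, $T_v$ is the subtree of $T$ induced by $v$ and all its successors, and $x_+=\max\{x,0\}$. The diametrical graph $G_X^d$ of a finite ultrametric space $(X,d)$ has vertex set $X$, with distinct $x,y$ adjacent if and only if $d(x,y)=\operatorname{diam}X$; when $|X|\ge 2$ it is complete multipartite with at least two parts. The representing tree $T_X$ is the rooted tree of subsets of $X$ with root $X$ in which a node $B$ with $|B|\ge 2$ has as its children the parts of the diametrical graph of the subspace $B$, and the one-point nodes are the leaves. $\widetilde T_X$ is the subgraph of $T_X$ induced by the set of internal nodes of $T_X$ (the nodes with at least two points), with root $X$. Rooted trees are isomorphic, written $\simeq$, if there is a graph isomorphism that maps root to root. A graph is hamiltonian if it has a Hamilton cycle, where cycles have at least three vertices. Theorem. Let $T=T(r)$ be a finite rooted tree and let $v_1,\dots,v_k$, $k\ge 1$, be the (distinct) children of $r$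 in $T$. Put $$ N=\begin{cases} 2\displaystyle\sum_{u\in V(T_{v_1})}(2-\delta^+(u))_+, & k=1,\\[2ex] \displaystyle\sum_{u\in V(T)}(2-\delta^+(u))_+ +\Bigl(2\max_{1\le i\le k}\sum_{u\in V(T_{v_i})}(2-\delta^+(u))_+-\sum_{u\in V(T)}(2-\delta^+(u))_+\Bigr)_+, & k\ge 2. \end{cases} $$ Then there is a finite ultrametric space $(X,d)$ such that (i) $T\simeq\widetilde T_X$; (ii) the diametrical graph $G_X^d$ is hamiltonian; (iii) $|X|=N$. Moreover, if $(Y,\rho)$ is a finite ultrametric space such that $T\simeq\widetilde T_Y$ and $G_Y^d$ is hamiltonian, then $|Y|\ge N$. -/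

import Mathlib

noncomputable section

open Classical in
/-- `Gr` contains a Hamilton cycle (a cycle has at least three vertices). -/
def HasHamiltonCycle {X : Type*} (Gr : SimpleGraph X) : Prop :=
  ∃ (a : X) (p : Gr.Walk a a), p.IsHamiltonianCycle

/-- A rooted tree on the vertex set `V`: a tree (connected acyclic graph) with a distinguished
vertex, the root. -/
structure RTree (V : Type*) where
  /-- the underlying graph -/
  graph : SimpleGraph V
  isTree : graph.IsTree
  /-- the root -/
  root : V

namespace RTree

variable {V : Type*} (T : RTree V)

/-- `u` is a successor of `v`: `u ≠ v` and `v` lies on the path joining the root to `u`. -/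
def IsSuccessor (u v : V) : Prop :=
  u ≠ v ∧ ∃ p : T.graph.Walk T.root u, p.IsPath ∧ v ∈ p.support

/-- The direct successors (children) of `v`. -/
def children (v : V) : Set V :=
  {u | T.IsSuccessor u v ∧ T.graph.Adj v u}

/-- The out-degree `δ⁺(v)`: the number of children of `v`. -/
def outDegree (v : V) : ℕ := (T.children v).ncard

/-- The vertex set of the subtree `T_v`, consisting of `v` and all its successors. -/
def subtreeVerts (v : V) : Set V :=
  {u | u = v ∨ T.IsSuccessor u v}

open Classical in
/-- The sum of `(2 - δ⁺(u))₊` over all vertices `u` of the subtree `T_v`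
(truncated subtraction on `ℕ` is the positive part). For `v` a vertex, the out-degree of
`u ∈ T_v` is the same in `T` and in `T_v`. -/
def subtreeSum [Fintype V] (v : V) : ℕ :=
  ∑ u ∈ Finset.univ.filter (fun u => u ∈ T.subtreeVerts v), (2 - T.outDegree u)

/-- The sum of `(2 - δ⁺(u))₊` over all vertices `u` of `T`. -/
def totalSum [Fintype V] : ℕ := ∑ u : V, (2 - T.outDegree u)

end RTree

/-- The diametrical graph of `X`: distinct points at distance `diam X` are adjacent. -/
def diametricalGraph (X : Type*) [MetricSpace X] : SimpleGraph X where
  Adj u v := u ≠ v ∧ dist u v = Metric.diam (Set.univ : Set X)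
  symm := ⟨fun u v h => ⟨h.1.symm, by rw [dist_comm]; exact h.2⟩⟩
  loopless := ⟨fun _ h => h.1 rfl⟩

/-- `A` is one of the parts of the diametrical graph (a complete multipartite graph) of the
subspace `B`, where `B` has at least two points. The part that contains `x` consists of all points
of `B` that are not adjacent to `x`. -/
def IsDiametricalPart {X : Type*} [MetricSpace X] (A B : Set X) : Prop :=
  B.Nontrivial ∧
    ∃ x : B, A = Subtype.val '' {y : B | ¬ (diametricalGraph B).Adj x y}

/-- The nodes of the representing tree of `X`: the whole space is a node (the root), and if a node
`B` has at least two points, then the parts of its diametrical graph are nodes. -/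
inductive IsRepresentingNode {X : Type*} [MetricSpace X] : Set X → Prop
  | root : IsRepresentingNode Set.univ
  | part {A B : Set X} : IsRepresentingNode B → IsDiametricalPart A B → IsRepresentingNode A

/-- The vertices of the representing tree of `X`. -/
abbrev RepresentingNode (X : Type*) [MetricSpace X] : Type _ :=
  {A : Set X // IsRepresentingNode A}

/-- The representing tree `T_X` of `X`, as a graph; its root is the whole space. The direct
successors of a node `B` with at least two points are the parts of its diametrical graph. -/
def representingTree (X : Type*) [MetricSpace X] : SimpleGraph (RepresentingNode X) :=
  SimpleGraph.fromRel fun A B => IsDiametricalPart A.1 B.1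

/-- The internal nodes of the representing tree: those whose label, the diameter, is positive. -/
def internalNodes (X : Type*) [MetricSpace X] : Set (RepresentingNode X) :=
  {A | 0 < Metric.diam A.1}

/-- `T̃_X`: the subgraph of the representing tree induced by the internal nodes. -/
def internalTree (X : Type*) [MetricSpace X] : SimpleGraph (internalNodes X) :=
  (representingTree X).induce (internalNodes X)

/-- `T ≃ T̃_X` as rooted trees: there is a graph isomorphism that maps the root of `T`
to the root `X` of `T̃_X`. -/
def RTree.IsoInternalTree {V : Type*} (T : RTree V) (X : Type*) [MetricSpace X] : Prop :=
  ∃ f : T.graph ≃g internalTree X, (f T.root).1.1 = Set.univ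

end

/-! ### Hamilton cycles -/

/-! In both cases `N` is the maximum of the total sum and twice the largest subtree sum at a child
of the root: for `k = 1` the total is `S + 1`, and `S ≥ 2` gives `2S ≥ S + 1`.

Lower bound. An internal node with `δ⁺` internal children has at least two parts, hence at least `(2
- δ⁺)₊` points lying in no smaller internal node. These points are disjoint for different nodes, so
summing over a subtree bounds the size of its top node (`sum_two_sub_ncard_le_ncard`). The node of a
child of the root is independent in the diametrical graph, so a Hamilton cycle leaves it at most
half of the space.

Construction. Attach `(2 - δ⁺(u))₊` points to each vertex `u` other than the root and all remaining
points to the root, and let points be closer the longer their vertices' root paths agree. The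
internal nodes are then the sets of points above a given vertex (`exists_equiv_internalNodes`).
Since no part exceeds half of the points, the complete multipartite diametrical graph is hamiltonian
(`hasHamiltonCycle_of_coloring`).

Both halves use orders instead of graphs: `RTree.isoInternalTree_iff` turns a rooted isomorphism
into an order-reversing bijection onto the internal nodes. -/

theorem cycleGraph_adj_iff_val {N : ℕ} (hN : 3 ≤ N) (i j : Fin N) :
    (SimpleGraph.cycleGraph N).Adj i j ↔
      ((i : ℕ) + 1 = j ∨ (j : ℕ) = 0 ∧ (i : ℕ) + 1 = N) ∨
        ((j : ℕ) + 1 = i ∨ (i : ℕ) = 0 ∧ (j : ℕ) + 1 = N) := by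
  have key : ∀ a b : Fin N, ((a - b : Fin N) : ℕ) = 1 ↔
      ((b : ℕ) + 1 = a ∨ (a : ℕ) = 0 ∧ (b : ℕ) + 1 = N) := by
    intro a b
    have ha := a.2
    have hb := b.2
    rw [Fin.sub_def]
    rcases lt_or_ge (N - b + a : ℕ) N with h | h
    · simp only [Nat.mod_eq_of_lt h]
      omega
    · simp only [Nat.mod_eq_sub_mod h]
      rw [Nat.mod_eq_of_lt (by omega)]
      omega
  rw [SimpleGraph.cycleGraph_adj', key, key, or_comm]

theorem hasHamiltonCycle_iff {X : Type*} [Finite X] (G : SimpleGraph X) :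
    HasHamiltonCycle G ↔ 3 ≤ Nat.card X ∧ ∃ e : Fin (Nat.card X) → X, Function.Injective e ∧
      ∀ i j, (SimpleGraph.cycleGraph (Nat.card X)).Adj i j → G.Adj (e i) (e j) := by
  classical
  have := Fintype.ofFinite X
  constructor
  · rintro ⟨a, p, hp⟩
    have hlen : p.length = Nat.card X := by
      rw [Nat.card_eq_fintype_card]
      convert hp.length_eq
    have h3 : 3 ≤ Nat.card X := hlen ▸ hp.isCycle.three_le_length
    obtain ⟨f⟩ := (SimpleGraph.cycleGraph_isContained_iff (G := G) (n := Nat.card X) (by omega)).2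
      ⟨a, p, hp.isCycle, hlen⟩
    exact ⟨h3, f, f.injective, fun i j h => f.toHom.map_adj h⟩
  · rintro ⟨h3, e, he, hadj⟩
    obtain ⟨a, p, hp, hlen⟩ :=
      (SimpleGraph.cycleGraph_isContained_iff (G := G) (n := Nat.card X) (by omega)).1
        ⟨⟨⟨e, fun {i j} h => hadj i j h⟩, he⟩⟩
    refine ⟨a, p, ?_⟩
    have := (SimpleGraph.Walk.isHamiltonianCycle_iff_isCycle_and_length_eq (p := p)).2
      ⟨hp, by rw [hlen, Nat.card_eq_fintype_card]⟩
    convert this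

/-- In a hamiltonian graph, an independent set contains at most half of the vertices. -/
theorem HasHamiltonCycle.two_mul_ncard_le {X : Type*} [Finite X] {G : SimpleGraph X}
    (hG : HasHamiltonCycle G) (A : Set X) (hA : ∀ x ∈ A, ∀ y ∈ A, ¬ G.Adj x y) :
    2 * A.ncard ≤ Nat.card X := by
  obtain ⟨h3, e, he, hadj⟩ := (hasHamiltonCycle_iff G).1 hG
  let N := Nat.card X
  -- The cyclic successor on positions: it is injective and moves the positions of an independent
  -- set off themselves, so two disjoint sets of equal size fit into the cycle.
  have hsucc : ∀ i : Fin N, ∃ j : Fin N, ((i : ℕ) + 1 = j ∨ (j : ℕ) = 0 ∧ (i : ℕ) + 1 = N) := by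
    intro i
    by_cases h : (i : ℕ) + 1 = N
    · exact ⟨⟨0, by omega⟩, Or.inr ⟨rfl, h⟩⟩
    · exact ⟨⟨i + 1, by have := i.2; omega⟩, Or.inl rfl⟩
  choose s hs using hsucc
  have hinj : Function.Injective s := by
    intro i j hij
    have h1 := hs i
    have h2 := hs j
    rw [hij] at h1
    ext
    omega
  have hbij : Function.Bijective e := (Nat.bijective_iff_injective_and_card e).2 ⟨he, by simp⟩
  let I : Set (Fin N) := e ⁻¹' A
  have hI : I.ncard = A.ncard :=
    Set.ncard_preimage_of_injective_subset_range he (by simp [hbij.surjective.range_eq])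
  have hdisj : Disjoint I (s '' I) := by
    rw [Set.disjoint_left]
    rintro _ hi ⟨j, hj, rfl⟩
    exact hA _ hj _ hi (hadj _ _ ((cycleGraph_adj_iff_val h3 _ _).2 (Or.inl (hs j))))
  calc 2 * A.ncard = I.ncard + (s '' I).ncard := by
        rw [Set.ncard_image_of_injective _ hinj, hI, two_mul]
    _ = (I ∪ s '' I).ncard := (Set.ncard_union_eq hdisj).symm
    _ ≤ Nat.card (Fin N) := Set.ncard_le_card _
    _ = Nat.card X := by simp [N]

/-- Two indices of a monotone enumeration of the vertices that lie in the same fibre force that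
fibre to be large. -/
theorem sub_lt_ncard_of_monotone {X : Type*} [Finite X] {N : ℕ} (e : Fin N ≃ X) (key : X → ℕ)
    (hmono : Monotone (key ∘ e)) (i j : Fin N) (h : key (e i) = key (e j)) :
    (j : ℕ) - i < {x | key x = key (e i)}.ncard ∨ j < i := by
  rcases lt_or_ge j i with hij | hij
  · exact Or.inr hij
  left
  have hsub : e '' (Finset.Icc i j : Set (Fin N)) ⊆ {x | key x = key (e i)} := by
    rintro _ ⟨l, hl, rfl⟩
    rw [Finset.coe_Icc, Set.mem_Icc] at hl
    exact le_antisymm ((hmono hl.2).trans h.ge) (hmono hl.1)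
  have := Set.ncard_le_ncard hsub (Set.toFinite _)
  rw [Set.ncard_image_of_injective _ e.injective, Set.ncard_coe_finset, Fin.card_Icc] at this
  have : (i : ℕ) ≤ j := hij
  omega

/-- A graph in which vertices of different colours are adjacent is hamiltonian if no colour is
used for more than half of the vertices. -/
theorem hasHamiltonCycle_of_coloring {X C : Type*} [Finite X] (G : SimpleGraph X)
    (h3 : 3 ≤ Nat.card X) (col : X → C) (hcol : ∀ x y, col x ≠ col y → G.Adj x y)
    (hsize : ∀ c, 2 * {x | col x = c}.ncard ≤ Nat.card X) : HasHamiltonCycle G := by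
  classical
  have := Fintype.ofFinite X
  have : Nonempty X := (Nat.card_pos_iff.1 (by omega)).1
  obtain ⟨x₀, hx₀⟩ := Finite.exists_max fun x => {y | col y = col x}.ncard
  obtain ⟨g, hg⟩ := Countable.exists_injective_nat (Set.range col)
  -- the largest colour class gets the key `0`
  let key : X → ℕ := fun x => if col x = col x₀ then 0 else g ⟨col x, x, rfl⟩ + 1
  have hkey : ∀ x y, key x = key y ↔ col x = col y := by
    intro x y
    by_cases hx : col x = col x₀ <;> by_cases hy : col y = col x₀
    · simp [key, hx, hy]
    · simp [key, hx, hy, Ne.symm hy]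
    · simp [key, hx, hy]
    · simp [key, hx, hy, hg.eq_iff, Subtype.ext_iff]
  have hclass : ∀ x, {y | key y = key x}.ncard ≤ {y | key y = 0}.ncard := by
    intro x
    have h0 : key x₀ = 0 := by simp [key]
    rw [← h0]
    simpa only [hkey] using hx₀ x
  have hhalf : ∀ x, 2 * {y | key y = key x}.ncard ≤ Nat.card X := by
    intro x
    simpa only [hkey] using hsize (col x)
  have hadj : ∀ x y, key x ≠ key y → G.Adj x y := fun x y h =>
    hcol x y fun h' => h ((hkey x y).2 h')
  obtain ⟨e, hmono⟩ : ∃ e : Fin (Nat.card X) ≃ X, Monotone (key ∘ e) := by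
    let e₀ : Fin (Nat.card X) ≃ X := (Finite.equivFin X).symm
    exact ⟨(Tuple.sort (key ∘ e₀)).trans e₀, Tuple.monotone_sort (key ∘ e₀)⟩
  refine (hasHamiltonCycle_iff G).2 ⟨h3, ?_⟩
  have hx₀key : key x₀ = 0 := by simp [key]
  have hgap := sub_lt_ncard_of_monotone e key hmono
  clear_value key
  clear hkey hsize hcol hx₀ hg
  generalize Nat.card X = N at *
  -- With the vertices sorted by colour, the cycle riffles the two halves of the list: even
  -- positions run through the first half, odd ones through the second. Cyclic neighbours then have
  -- indices about `N / 2` apart.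
  have hτ : ∀ j : Fin N, ∃ i : Fin N, ((j : ℕ) % 2 = 0 ∧ (i : ℕ) = j / 2) ∨
      ((j : ℕ) % 2 = 1 ∧ (i : ℕ) = j / 2 + (N + 1) / 2) := by
    intro j
    have := j.2
    rcases Nat.mod_two_eq_zero_or_one j with h | h
    · exact ⟨⟨j / 2, by omega⟩, Or.inl ⟨h, rfl⟩⟩
    · exact ⟨⟨j / 2 + (N + 1) / 2, by omega⟩, Or.inr ⟨h, rfl⟩⟩
  choose τ hτ using hτ
  have hτinj : Function.Injective τ := by
    intro i j hij
    have h1 := hτ i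
    have h2 := hτ j
    have := i.2
    have := j.2
    rw [hij] at h1
    ext
    omega
  -- A class containing the indices `i < j` has at least `j - i + 1` elements, too many in the first
  -- case. The second case, possible only for even `N`, would need a class of exactly half the
  -- vertices starting at `i`. If it has key `0`, it also contains index `0` and is too large;
  -- otherwise the class of key `0` fits below `i` and is not the largest.
  have hfar : ∀ i j : Fin N, (i : ℕ) < j → (N < 2 * (j - i + 1) ∨
      (2 * ((j : ℕ) - i + 1) = N ∧ 1 ≤ (i : ℕ) ∧ 2 * i < N - 1)) → key (e i) ≠ key (e j) := by
    intro i j hij hd h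
    have h1 := (hgap i j h).resolve_right (by rw [Fin.lt_def]; omega)
    have h2 := hhalf (e i)
    rcases hd with hd | ⟨hd, hi, hi'⟩
    · omega
    obtain ⟨i₀, hi₀⟩ := e.surjective x₀
    let z : Fin N := ⟨0, by omega⟩
    have hz : key (e z) = 0 := by
      have := hmono (show z ≤ i₀ from Nat.zero_le _)
      simp only [Function.comp_apply, hi₀, hx₀key] at this
      omega
    by_cases h0 : key (e i) = 0
    · have := (hgap z j (by rw [hz, ← h, h0])).resolve_right
        (not_lt.2 (show z ≤ j from Nat.zero_le _))
      rw [hz, ← h0] at this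
      simp only [z] at this
      omega
    · have hsub : {y | key y = 0} ⊆ e '' (Finset.Iio i : Set (Fin N)) := by
        intro y hy
        obtain ⟨l, rfl⟩ := e.surjective y
        refine ⟨l, ?_, rfl⟩
        rw [Finset.coe_Iio, Set.mem_Iio]
        by_contra hl
        have := hmono (not_lt.1 hl)
        simp only [Function.comp_apply] at this
        have hy' : key (e l) = 0 := hy
        omega
      have h3 := Set.ncard_le_ncard hsub (Set.toFinite _)
      rw [Set.ncard_image_of_injective _ e.injective, Set.ncard_coe_finset, Fin.card_Iio] at h3
      have h4 := hclass (e i)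
      omega
  have hne : ∀ i j : Fin N, ((i : ℕ) + 1 = j ∨ (j : ℕ) = 0 ∧ (i : ℕ) + 1 = N) →
      key (e (τ i)) ≠ key (e (τ j)) := by
    intro i j hij
    have h1 := hτ i
    have h2 := hτ j
    have := i.2
    have := j.2
    rcases lt_trichotomy (τ i : ℕ) (τ j) with h | h | h
    · exact hfar _ _ h (by omega)
    · omega
    · exact (hfar _ _ h (by omega)).symm
  refine ⟨e ∘ τ, e.injective.comp hτinj, fun i j hij => ?_⟩
  rcases (cycleGraph_adj_iff_val h3 _ _).1 hij with h | h
  · exact hadj _ _ (hne i j h)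
  · exact (hadj _ _ (hne j i h)).symm

/-! ### The order of a rooted tree -/

namespace RTree

variable {V : Type*} (T : RTree V)

/-- `v` lies on the path joining the root to `u`. -/
def Anc (v u : V) : Prop := ∃ p : T.graph.Walk T.root u, p.IsPath ∧ v ∈ p.support

variable {T}

theorem path_eq {u v : V} {p q : T.graph.Walk u v} (hp : p.IsPath) (hq : q.IsPath) : p = q :=
  (T.isTree.existsUnique_path u v).unique hp hq

theorem exists_path (u : V) : ∃ p : T.graph.Walk T.root u, p.IsPath :=
  (T.isTree.existsUnique_path T.root u).exists

theorem anc_iff_mem_support {v u : V} {p : T.graph.Walk T.root u} (hp : p.IsPath) :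
    T.Anc v u ↔ v ∈ p.support :=
  ⟨fun ⟨_, hq, hv⟩ => path_eq hq hp ▸ hv, fun h => ⟨p, hp, h⟩⟩

theorem anc_refl (u : V) : T.Anc u u := by
  obtain ⟨p, hp⟩ := T.exists_path u
  exact ⟨p, hp, p.end_mem_support⟩

theorem root_anc (u : V) : T.Anc T.root u := by
  obtain ⟨p, hp⟩ := T.exists_path u
  exact ⟨p, hp, p.start_mem_support⟩

theorem Anc.trans {a b c : V} (hab : T.Anc a b) (hbc : T.Anc b c) : T.Anc a c := by
  classical
  obtain ⟨p, hp, hb⟩ := hbc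
  rw [anc_iff_mem_support (hp.takeUntil hb)] at hab
  exact ⟨p, hp, p.support_takeUntil_subset_support hb hab⟩

theorem Anc.antisymm {a b : V} (hab : T.Anc a b) (hba : T.Anc b a) : a = b := by
  classical
  by_contra hne
  obtain ⟨p, hp, ha⟩ := hab
  rw [anc_iff_mem_support (hp.takeUntil ha)] at hba
  exact SimpleGraph.Walk.endpoint_notMem_support_takeUntil hp ha (Ne.symm hne) hba

/-- Both vertices lie on the root path of `c`, where their positions compare them. -/
theorem Anc.total {a b c : V} (hac : T.Anc a c) (hbc : T.Anc b c) : T.Anc a b ∨ T.Anc b a := by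
  obtain ⟨p, hp⟩ := T.exists_path c
  rw [anc_iff_mem_support hp, SimpleGraph.Walk.mem_support_iff_exists_getVert] at hac hbc
  obtain ⟨i, rfl, -⟩ := hac
  obtain ⟨j, rfl, -⟩ := hbc
  have key : ∀ i j, i ≤ j → T.Anc (p.getVert i) (p.getVert j) := by
    intro i j hij
    refine ⟨p.take j, hp.take j, ?_⟩
    have := (p.take j).getVert_mem_support i
    rwa [p.take_getVert, min_eq_right hij] at this
  exact (le_total i j).imp (key i j) (key j i)

/-- An edge from `u` to a vertex `w` off the root path of `u` extends that path by `w` alone, so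
nothing lies strictly between. Conversely, the last edge of the root path of `w` starts at a vertex
between `u` and `w`, which must be `u`. -/
theorem adj_iff_anc {u w : V} : T.graph.Adj u w ↔
    (T.Anc u w ∧ u ≠ w ∧ ∀ x, T.Anc u x → T.Anc x w → x = u ∨ x = w) ∨
      (T.Anc w u ∧ w ≠ u ∧ ∀ x, T.Anc w x → T.Anc x u → x = w ∨ x = u) := by
  constructor
  · have key : ∀ u w, T.graph.Adj u w → T.Anc u w →
        (T.Anc u w ∧ u ≠ w ∧ ∀ x, T.Anc u x → T.Anc x w → x = u ∨ x = w) := by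
      intro u w h huw
      refine ⟨huw, h.ne, fun x hux hxw => ?_⟩
      obtain ⟨p, hp⟩ := T.exists_path u
      have hw : w ∉ p.support := fun hw => h.ne (huw.antisymm ((anc_iff_mem_support hp).2 hw))
      rw [anc_iff_mem_support (hp.concat hw h), SimpleGraph.Walk.support_concat, List.mem_append,
        List.mem_singleton] at hxw
      exact hxw.imp_left fun hx => ((anc_iff_mem_support hp).2 hx).antisymm hux
    intro h
    obtain ⟨p, hp⟩ := T.exists_path u
    by_cases hw : w ∈ p.support
    · exact Or.inr (key w u h.symm ((anc_iff_mem_support hp).2 hw))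
    · refine Or.inl (key u w h ⟨p.concat h, hp.concat hw h, ?_⟩)
      rw [SimpleGraph.Walk.support_concat]
      exact List.mem_append_left _ p.end_mem_support
  · have key : ∀ u w, T.Anc u w → u ≠ w → (∀ x, T.Anc u x → T.Anc x w → x = u ∨ x = w) →
        T.graph.Adj u w := by
      intro u w huw hne hcov
      obtain ⟨q, hq⟩ := T.exists_path w
      have hnil : ¬ q.Nil := by
        intro hnil
        have hw := hnil.eq
        exact hne (huw.antisymm (hw ▸ root_anc u))
      have hadj := q.adj_penultimate hnil
      have hq' := q.concat_dropLast hadj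
      rw [anc_iff_mem_support hq, ← hq', SimpleGraph.Walk.support_concat, List.mem_append,
        List.mem_singleton] at huw
      have hux : T.Anc u q.penultimate := ⟨q.dropLast, hq.dropLast, huw.resolve_right hne⟩
      have hxw : T.Anc q.penultimate w := ⟨q, hq, q.getVert_mem_support _⟩
      rcases hcov _ hux hxw with h | h
      · rwa [h] at hadj
      · exact absurd h hadj.ne
    rintro (⟨h1, h2, h3⟩ | ⟨h1, h2, h3⟩)
    · exact key u w h1 h2 h3
    · exact (key w u h1 h2 h3).symm

variable (T) in
/-- The vertices of a rooted tree, ordered with the root at the bottom. -/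
abbrev partialOrder : PartialOrder V where
  le := T.Anc
  le_refl := anc_refl
  le_trans _ _ _ := Anc.trans
  le_antisymm _ _ := Anc.antisymm

theorem covBy_iff {u w : V} : (letI := T.partialOrder; u ⋖ w) ↔
    T.Anc u w ∧ u ≠ w ∧ ∀ x, T.Anc u x → T.Anc x w → x = u ∨ x = w := by
  let := T.partialOrder
  constructor
  · intro h
    exact ⟨h.le, h.ne, fun x h1 h2 => h.eq_or_eq h1 h2⟩
  · rintro ⟨h1, h2, h3⟩
    refine ⟨lt_of_le_of_ne h1 h2, fun x hx hx' => ?_⟩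
    rcases h3 x hx.le hx'.le with rfl | rfl
    · exact lt_irrefl _ hx
    · exact lt_irrefl _ hx'

theorem adj_iff_covBy {u w : V} :
    T.graph.Adj u w ↔ (letI := T.partialOrder; u ⋖ w ∨ w ⋖ u) := by
  rw [adj_iff_anc, covBy_iff, covBy_iff]

theorem mem_children_iff {u w : V} : w ∈ T.children u ↔ (letI := T.partialOrder; u ⋖ w) := by
  let := T.partialOrder
  change (w ≠ u ∧ T.Anc u w) ∧ T.graph.Adj u w ↔ u ⋖ w
  rw [adj_iff_covBy]
  constructor
  · rintro ⟨⟨h1, h2⟩, h | h⟩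
    · exact h
    · exact absurd (h2.antisymm h.le) h1.symm
  · intro h
    exact ⟨⟨h.ne', h.le⟩, Or.inl h⟩

theorem mem_subtreeVerts_iff {u v : V} : u ∈ T.subtreeVerts v ↔ T.Anc v u := by
  change (u = v ∨ u ≠ v ∧ T.Anc v u) ↔ _
  by_cases h : u = v
  · simp [h, anc_refl]
  · simp [h]

end RTree

/-- In a finite order with a greatest element in which the elements above any given one form a
chain, every element is joined to the top, in the Hasse diagram, by a path through exactly the
elements above it. -/
theorem exists_path_support_eq_Ici {P : Type*} [PartialOrder P] [Finite P]
    (hc : ∀ a b c : P, a ≤ b → a ≤ c → b ≤ c ∨ c ≤ b) (t : P) (ht : ∀ a, a ≤ t)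
    (H : SimpleGraph P) (hH : ∀ a b, H.Adj a b ↔ a ⋖ b ∨ b ⋖ a) (a : P) :
    ∃ p : H.Walk t a, p.IsPath ∧ ∀ x, x ∈ p.support ↔ a ≤ x := by
  induction a using WellFoundedGT.induction with
  | ind a ih =>
    by_cases hat : a = t
    · subst hat
      refine ⟨.nil, by simp, fun x => ?_⟩
      simp only [SimpleGraph.Walk.support_nil, List.mem_singleton]
      exact ⟨fun h => h.ge, fun h => le_antisymm (ht x) h⟩
    · obtain ⟨b, hab, -⟩ := exists_covBy_le_of_lt (lt_of_le_of_ne (ht a) hat)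
      obtain ⟨p, hp, hsupp⟩ := ih b hab.lt
      refine ⟨p.concat ((hH b a).2 (Or.inr hab)), hp.concat ?_ _, fun x => ?_⟩
      · rw [hsupp]
        exact not_le_of_gt hab.lt
      · rw [SimpleGraph.Walk.support_concat, List.mem_append, List.mem_singleton, hsupp]
        constructor
        · rintro (h | rfl)
          · exact hab.le.trans h
          · exact le_rfl
        · intro h
          rcases hc a b x hab.le h with h' | h'
          · exact Or.inl h'
          · exact (hab.eq_or_eq h h').symm.imp (fun h => h.ge) id

/-- A graph isomorphism from a rooted tree to the Hasse diagram of such an order, mapping the root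
to the top, reverses the orders. -/
theorem RTree.anc_iff_le_of_iso {V P : Type*} (T : RTree V) [PartialOrder P] [Finite P]
    (hc : ∀ a b c : P, a ≤ b → a ≤ c → b ≤ c ∨ c ≤ b)
    (H : SimpleGraph P) (hH : ∀ a b, H.Adj a b ↔ a ⋖ b ∨ b ⋖ a) (f : T.graph ≃g H)
    (ht : ∀ a, a ≤ f T.root) (u v : V) : T.Anc v u ↔ f u ≤ f v := by
  obtain ⟨p, hp, hsupp⟩ := exists_path_support_eq_Ici hc (f T.root) ht H hH (f u)
  rw [← hsupp]
  let q : T.graph.Walk T.root u := (p.map f.symm.toHom).copy (by simp) (by simp)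
  have hq : q.IsPath := by
    simp only [q, SimpleGraph.Walk.isPath_copy]
    exact hp.map f.symm.injective
  rw [RTree.anc_iff_mem_support hq]
  simp only [q, SimpleGraph.Walk.support_copy, SimpleGraph.Walk.support_map, List.mem_map]
  constructor
  · rintro ⟨x, hx, rfl⟩
    simpa using hx
  · intro h
    exact ⟨f v, h, by simp⟩

/-! ### Nodes of the representing tree of a finite ultrametric space -/

section Ultrametric

variable {X : Type*} [MetricSpace X]

theorem nontrivial_of_diam_pos {A : Set X} (h : 0 < Metric.diam A) : A.Nontrivial := by
  by_contra hA
  rw [Set.not_nontrivial_iff] at hA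
  exact h.ne' (Metric.diam_subsingleton hA)

variable [Finite X]

theorem dist_le_diam_of_finite {A : Set X} {x y : X} (hx : x ∈ A) (hy : y ∈ A) :
    dist x y ≤ Metric.diam A :=
  Metric.dist_le_diam_of_mem (Set.toFinite A).isBounded hx hy

theorem diam_mono_of_finite {A B : Set X} (h : A ⊆ B) : Metric.diam A ≤ Metric.diam B :=
  Metric.diam_mono h (Set.toFinite B).isBounded

theorem diam_pos_of_nontrivial {A : Set X} (h : A.Nontrivial) : 0 < Metric.diam A := by
  obtain ⟨x, hx, y, hy, hne⟩ := h
  exact (dist_pos.2 hne).trans_le (dist_le_diam_of_finite hx hy)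

/-- Nonadjacency in the diametrical graph of `B` means distance below the diameter, so parts are
open balls of radius `diam B` inside `B`. -/
theorem isDiametricalPart_iff (A B : Set X) : IsDiametricalPart A B ↔
    B.Nontrivial ∧ ∃ x ∈ B, A = {y | y ∈ B ∧ dist x y < Metric.diam B} := by
  unfold IsDiametricalPart
  refine and_congr_right fun hB => ?_
  have hdiam : Metric.diam (Set.univ : Set B) = Metric.diam B := by
    rw [← (isometry_subtype_coe (s := B)).diam_image, Set.image_univ, Subtype.range_coe]
  have key : ∀ x : B, Subtype.val '' {y : B | ¬ (diametricalGraph B).Adj x y} =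
      {y | y ∈ B ∧ dist (x : X) y < Metric.diam B} := by
    intro x
    ext y
    simp only [Set.mem_image, Set.mem_ofPred_eq, Subtype.exists, exists_and_right, exists_eq_right]
    constructor
    · rintro ⟨hy, h⟩
      refine ⟨hy, lt_of_le_of_ne (dist_le_diam_of_finite x.2 hy) fun he => h ⟨?_, ?_⟩⟩
      · rintro rfl
        rw [dist_self] at he
        exact (diam_pos_of_nontrivial hB).ne he
      · rw [hdiam]
        exact he
    · rintro ⟨hy, h⟩
      refine ⟨hy, fun h' => h.ne ?_⟩
      have := h'.2
      rwa [hdiam] at this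
  constructor
  · rintro ⟨x, rfl⟩
    exact ⟨x, x.2, key x⟩
  · rintro ⟨x, hx, rfl⟩
    exact ⟨⟨x, hx⟩, (key ⟨x, hx⟩).symm⟩

/-- A nonempty subset of smaller diameter is contained in a part of the diametrical graph. -/
theorem exists_isDiametricalPart_superset {A B : Set X} (hAB : A ⊆ B) (hne : A.Nonempty)
    (hdiam : Metric.diam A < Metric.diam B) : ∃ C, IsDiametricalPart C B ∧ A ⊆ C := by
  obtain ⟨x, hx⟩ := hne
  refine ⟨_, (isDiametricalPart_iff _ B).2
    ⟨nontrivial_of_diam_pos (Metric.diam_nonneg.trans_lt hdiam), x, hAB hx, rfl⟩, fun y hy => ?_⟩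
  exact ⟨hAB hy, (dist_le_diam_of_finite hx hy).trans_lt hdiam⟩

variable [IsUltrametricDist X]

theorem exists_dist_eq_diam {A : Set X} {x : X} (hx : x ∈ A) :
    ∃ y ∈ A, dist x y = Metric.diam A := by
  obtain ⟨y, hy, hmax⟩ := Set.exists_max_image A (dist x) (Set.toFinite A) ⟨x, hx⟩
  refine ⟨y, hy, le_antisymm (dist_le_diam_of_finite hx hy) ?_⟩
  refine Metric.diam_le_of_forall_dist_le dist_nonneg fun a ha b hb => ?_
  refine (dist_triangle_max a x b).trans (max_le ?_ (hmax b hb))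
  rw [dist_comm]
  exact hmax a ha

/-- Nodes are closed balls with their own diameter as radius, centred at any of their points. This
passes from a node to its parts by the strong triangle inequality, and makes nodes sharing a point
nested. -/
theorem IsRepresentingNode.mem_of_dist_le {A : Set X} (hA : IsRepresentingNode A) {x y : X}
    (hx : x ∈ A) (h : dist x y ≤ Metric.diam A) : y ∈ A := by
  induction hA generalizing x y with
  | root => trivial
  | @part A B _ hAB ih =>
    obtain ⟨hB, z, hz, rfl⟩ := (isDiametricalPart_iff A B).1 hAB
    have hsub : {y | y ∈ B ∧ dist z y < Metric.diam B} ⊆ B := fun _ h => h.1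
    refine ⟨ih hx.1 (h.trans (diam_mono_of_finite hsub)), ?_⟩
    obtain ⟨w, hw, hxw⟩ := exists_dist_eq_diam hx
    rw [← hxw] at h
    have hlt : dist x w < Metric.diam B :=
      (dist_triangle_max x z w).trans_lt (max_lt (by rw [dist_comm]; exact hx.2) hw.2)
    exact (dist_triangle_max z x y).trans_lt (max_lt hx.2 (h.trans_lt hlt))

theorem IsRepresentingNode.diam_lt {A B : Set X} (hA : IsRepresentingNode A) (hAB : A ⊂ B)
    (hne : A.Nonempty) : Metric.diam A < Metric.diam B := by
  by_contra h
  obtain ⟨x, hx⟩ := hne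
  exact hAB.2 fun y hy =>
    hA.mem_of_dist_le hx ((dist_le_diam_of_finite (hAB.1 hx) hy).trans (not_lt.1 h))

theorem IsRepresentingNode.subset_or_subset {A B : Set X} (hA : IsRepresentingNode A)
    (hB : IsRepresentingNode B) {x : X} (hxA : x ∈ A) (hxB : x ∈ B) : A ⊆ B ∨ B ⊆ A := by
  rcases le_total (Metric.diam A) (Metric.diam B) with h | h
  · exact Or.inl fun y hy => hB.mem_of_dist_le hxB ((dist_le_diam_of_finite hxA hy).trans h)
  · exact Or.inr fun y hy => hA.mem_of_dist_le hxA ((dist_le_diam_of_finite hxB hy).trans h)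

theorem IsDiametricalPart.ssubset {A B : Set X} (h : IsDiametricalPart A B) : A ⊂ B := by
  obtain ⟨hB, z, hz, rfl⟩ := (isDiametricalPart_iff A B).1 h
  refine ⟨fun _ h => h.1, fun hsub => ?_⟩
  obtain ⟨w, hw, hzw⟩ := exists_dist_eq_diam hz
  exact (hsub hw).2.ne hzw

/-- The nodes of the representing tree are exactly the balls. -/
theorem isRepresentingNode_of_forall_mem {A : Set X} (hne : A.Nonempty)
    (h : ∀ x ∈ A, ∀ y, dist x y ≤ Metric.diam A → y ∈ A) : IsRepresentingNode A := by
  -- Take a smallest node `B` containing `A`. If `A` is not a node, the ball property gives it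
  -- smaller diameter than `B`, so it fits into a part of `B`, against minimality.
  obtain ⟨B, ⟨hB, hAB⟩, hmin⟩ :=
    (Set.toFinite {B : Set X | IsRepresentingNode B ∧ A ⊆ B}).exists_minimal
      ⟨Set.univ, .root, Set.subset_univ A⟩
  by_contra hA
  have hdiam : Metric.diam A < Metric.diam B := by
    by_contra hlt
    obtain ⟨x, hx⟩ := hne
    have : A = B := hAB.antisymm fun y hy =>
      h x hx y ((dist_le_diam_of_finite (hAB hx) hy).trans (not_lt.1 hlt))
    exact hA (this ▸ hB)
  obtain ⟨C, hC, hAC⟩ := exists_isDiametricalPart_superset hAB hne hdiam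
  exact hC.ssubset.2 (hmin ⟨.part hB hC, hAC⟩ hC.ssubset.1)

theorem isDiametricalPart_iff_of_isRepresentingNode {A B : Set X} (hA : IsRepresentingNode A)
    (hB : IsRepresentingNode B) (hne : A.Nonempty) : IsDiametricalPart A B ↔
      A ⊂ B ∧ ∀ C, IsRepresentingNode C → A ⊆ C → C ⊂ B → C = A := by
  constructor
  · intro h
    refine ⟨h.ssubset, fun C hC hAC hCB => ?_⟩
    have hdiam := hC.diam_lt hCB (hne.mono hAC)
    obtain ⟨hBn, z, hz, rfl⟩ := (isDiametricalPart_iff A B).1 h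
    refine (hAC.antisymm fun y hy => ⟨hCB.1 hy, ?_⟩).symm
    have hzC : z ∈ C := hAC ⟨hz, by rw [dist_self]; exact diam_pos_of_nontrivial hBn⟩
    exact (dist_le_diam_of_finite hzC hy).trans_lt hdiam
  · rintro ⟨hAB, h⟩
    obtain ⟨C, hC, hAC⟩ := exists_isDiametricalPart_superset hAB.1 hne (hA.diam_lt hAB hne)
    exact h C (.part hB hC) hAC hC.ssubset ▸ hC

/-- Parts are the nodes covered by `B` under inclusion. Restricting to internal nodes keeps the
coverings, because every node containing an internal one is internal. -/
theorem internalTree_adj_iff (A B : internalNodes X) :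
    (internalTree X).Adj A B ↔ A ⋖ B ∨ B ⋖ A := by
  have key : ∀ A B : internalNodes X, IsDiametricalPart A.1.1 B.1.1 ↔ A ⋖ B := by
    intro A B
    have hlt : ∀ C D : internalNodes X, C < D ↔ C.1.1 ⊂ D.1.1 := fun C D => Iff.rfl
    have hne : A.1.1.Nonempty := (nontrivial_of_diam_pos A.2).nonempty
    rw [isDiametricalPart_iff_of_isRepresentingNode A.1.2 B.1.2 hne]
    constructor
    · rintro ⟨h1, h2⟩
      refine ⟨h1, fun C hAC hCB => ?_⟩
      exact ((hlt A C).1 hAC).ne (h2 C.1.1 C.1.2 hAC.le hCB).symm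
    · intro h
      refine ⟨h.lt, fun C hC hAC hCB => ?_⟩
      let C' : internalNodes X := ⟨⟨C, hC⟩, (show 0 < Metric.diam A.1.1 from A.2).trans_le
        (diam_mono_of_finite hAC)⟩
      by_contra hCA
      exact h.2 (c := C') ((hlt A C').2 (hAC.ssubset_of_ne (Ne.symm hCA))) hCB
  change (representingTree X).Adj A.1 B.1 ↔ _
  rw [representingTree, SimpleGraph.fromRel_adj, key, key]
  refine and_iff_right_of_imp ?_
  rintro (h | h) h'
  · exact h.ne (Subtype.ext h')
  · exact h.ne' (Subtype.ext h')

theorem RTree.isoInternalTree_iff {V : Type*} (T : RTree V) : T.IsoInternalTree X ↔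
    ∃ f : V ≃ internalNodes X, ∀ u v, T.Anc v u ↔ (f u).1.1 ⊆ (f v).1.1 := by
  constructor
  · rintro ⟨f, hf⟩
    refine ⟨f.toEquiv, T.anc_iff_le_of_iso ?_ _ internalTree_adj_iff f ?_⟩
    · intro A B C hAB hAC
      obtain ⟨x, hx⟩ := (nontrivial_of_diam_pos A.2).nonempty
      exact B.1.2.subset_or_subset C.1.2 (hAB hx) (hAC hx)
    · intro A
      change A.1.1 ⊆ (f T.root).1.1
      rw [hf]
      exact Set.subset_univ _
  · rintro ⟨f, hf⟩
    let : PartialOrder V := T.partialOrder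
    have hle : ∀ u v, f u ≤ f v ↔ v ≤ u := fun u v => (hf u v).symm
    have hlt : ∀ u v, f u < f v ↔ v < u := fun u v => by
      rw [lt_iff_le_not_ge, lt_iff_le_not_ge, hle, hle]
    have hcov : ∀ u v, f u ⋖ f v ↔ v ⋖ u := by
      intro u v
      unfold CovBy
      rw [hlt, f.surjective.forall]
      simp only [hlt]
      exact and_congr_right fun _ => forall_congr' fun _ => ⟨fun h a b => h b a, fun h a b => h b a⟩
    refine ⟨⟨f, fun {u v} => ?_⟩, ?_⟩
    · rw [internalTree_adj_iff, hcov, hcov, RTree.adj_iff_covBy, or_comm]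
    -- The whole space contains an internal node, hence is internal and equals some `f u`; as the
    -- root is an ancestor of `u`, its image contains everything.
    · have hpos : 0 < Metric.diam (Set.univ : Set X) :=
        (show 0 < Metric.diam (f T.root).1.1 from (f T.root).2).trans_le
          (diam_mono_of_finite (Set.subset_univ _))
      obtain ⟨u, hu⟩ := f.surjective ⟨⟨Set.univ, .root⟩, hpos⟩
      have := (hf u T.root).1 (RTree.root_anc u)
      rw [hu] at this
      exact Set.univ_subset_iff.1 this

end Ultrametric

/-! ### The number of points of a space with a prescribed internal tree -/

section LowerBound

variable {V : Type*} [PartialOrder V]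
  {X : Type*} [MetricSpace X] [Finite X] [IsUltrametricDist X]
  (f : V ≃ internalNodes X)

/-- The points of the node `f u` that lie in no smaller internal node. -/
def leafPoints (u : V) : Set X := {y | y ∈ (f u).1.1 ∧ ∀ w, u < w → y ∉ (f w).1.1}

variable {f}

theorem disjoint_leafPoints (hf : ∀ u v, v ≤ u ↔ (f u).1.1 ⊆ (f v).1.1) {u v : V} (h : u ≠ v) :
    Disjoint (leafPoints f u) (leafPoints f v) := by
  rw [Set.disjoint_left]
  intro y hu hv
  rcases (f u).1.2.subset_or_subset (f v).1.2 hu.1 hv.1 with h' | h'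
  · exact hv.2 u (lt_of_le_of_ne ((hf u v).2 h') h.symm) hu.1
  · exact hu.2 v (lt_of_le_of_ne ((hf v u).2 h') h) hv.1

variable [Fintype V]

/-- Take two points of `f u` at distance `diam (f u)`. Label each by itself if it is a leaf point,
otherwise by a child of `u` whose node contains it. The labels differ, because a child's node has
smaller diameter; so leaf points and children together number at least two. -/
theorem two_sub_ncard_le_ncard_leafPoints (hf : ∀ u v, v ≤ u ↔ (f u).1.1 ⊆ (f v).1.1) (u : V) :
    2 - {w | u ⋖ w}.ncard ≤ (leafPoints f u).ncard := by
  classical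
  obtain ⟨x, hx⟩ := (nontrivial_of_diam_pos (f u).2).nonempty
  obtain ⟨y, hy, hxy⟩ := exists_dist_eq_diam hx
  have hg : ∀ z ∈ (f u).1.1, ∃ s : X ⊕ V, (s = Sum.inl z ∧ z ∈ leafPoints f u) ∨
      ∃ w, s = Sum.inr w ∧ u ⋖ w ∧ z ∈ (f w).1.1 := by
    intro z hz
    by_cases hzl : z ∈ leafPoints f u
    · exact ⟨_, Or.inl ⟨rfl, hzl⟩⟩
    · have : ∃ w, u < w ∧ z ∈ (f w).1.1 := by
        by_contra hcon
        exact hzl ⟨hz, fun w hw hzw => hcon ⟨w, hw, hzw⟩⟩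
      obtain ⟨w, huw, hzw⟩ := this
      obtain ⟨c, huc, hcw⟩ := exists_covBy_le_of_lt huw
      exact ⟨_, Or.inr ⟨c, rfl, huc, (hf w c).1 hcw hzw⟩⟩
  obtain ⟨s, hs⟩ := hg x hx
  obtain ⟨t, ht⟩ := hg y hy
  have hpos : 0 < Metric.diam (f u).1.1 := (f u).2
  have hst : s ≠ t := by
    rintro rfl
    rcases hs with ⟨rfl, -⟩ | ⟨w, rfl, huw, hxw⟩
    · rcases ht with ⟨h, -⟩ | ⟨w, h, -⟩
      · rw [Sum.inl.injEq] at h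
        rw [h, dist_self] at hxy
        exact hpos.ne hxy
      · exact Sum.inl_ne_inr h
    · rcases ht with ⟨h, -⟩ | ⟨w', h, -, hyw⟩
      · exact Sum.inr_ne_inl h
      · rw [Sum.inr.injEq] at h
        subst h
        have hsub : (f w).1.1 ⊂ (f u).1.1 :=
          ⟨(hf w u).1 huw.le, fun h => huw.lt.not_ge ((hf u w).2 h)⟩
        have := (f w).1.2.diam_lt hsub ⟨x, hxw⟩
        exact absurd (dist_le_diam_of_finite hxw hyw) (by rw [hxy]; exact not_le.2 this)
  have hmem : ∀ z s, ((s = Sum.inl z ∧ z ∈ leafPoints f u) ∨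
      ∃ w, s = Sum.inr w ∧ u ⋖ w ∧ z ∈ (f w).1.1) →
      s ∈ (Sum.inl '' leafPoints f u ∪ Sum.inr '' {w | u ⋖ w} : Set (X ⊕ V)) := by
    rintro z s (⟨rfl, h⟩ | ⟨w, rfl, h, -⟩)
    · exact Or.inl ⟨z, h, rfl⟩
    · exact Or.inr ⟨w, h, rfl⟩
  have hsub : {s, t} ⊆ (Sum.inl '' leafPoints f u ∪ Sum.inr '' {w | u ⋖ w} : Set (X ⊕ V)) :=
    Set.pair_subset (hmem x s hs) (hmem y t ht)
  have h1 := Set.ncard_le_ncard hsub (Set.toFinite _)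
  have h2 := Set.ncard_union_le (Sum.inl '' leafPoints f u : Set (X ⊕ V)) (Sum.inr '' {w | u ⋖ w})
  rw [Set.ncard_pair hst] at h1
  rw [Set.ncard_image_of_injective _ Sum.inl_injective,
    Set.ncard_image_of_injective _ Sum.inr_injective] at h2
  omega

theorem sum_two_sub_ncard_le_ncard (hf : ∀ u v, v ≤ u ↔ (f u).1.1 ⊆ (f v).1.1) (s : Finset V)
    (A : Set X) (hA : ∀ u ∈ s, (f u).1.1 ⊆ A) : ∑ u ∈ s, (2 - {w | u ⋖ w}.ncard) ≤ A.ncard := by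
  classical
  have : Fintype X := Fintype.ofFinite X
  calc ∑ u ∈ s, (2 - {w | u ⋖ w}.ncard) ≤ ∑ u ∈ s, (leafPoints f u).toFinset.card :=
        Finset.sum_le_sum fun u _ => by
          rw [← Set.ncard_eq_toFinset_card']
          exact two_sub_ncard_le_ncard_leafPoints hf u
    _ = (s.biUnion fun u => (leafPoints f u).toFinset).card := by
        rw [Finset.card_biUnion]
        intro u _ v _ h
        exact Set.disjoint_toFinset.2 (disjoint_leafPoints hf h)
    _ ≤ A.toFinset.card := by
        refine Finset.card_le_card (Finset.biUnion_subset.2 fun u hu => ?_)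
        exact Set.toFinset_mono fun y hy => hA u hu hy.1
    _ = A.ncard := (Set.ncard_eq_toFinset_card' A).symm

end LowerBound

/-! ### A space with a prescribed internal tree -/

section Construction

variable {V : Type*} [PartialOrder V]

/-- The number of common lower bounds of `u` and `w`. -/
noncomputable def commonCount (u w : V) : ℕ := {a | a ≤ u ∧ a ≤ w}.ncard

theorem commonCount_comm (u w : V) : commonCount u w = commonCount w u := by
  simp only [commonCount, and_comm]

variable [Fintype V]

theorem commonCount_le (u w : V) : commonCount u w ≤ Fintype.card V := by
  rw [← Nat.card_eq_fintype_card]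
  exact Set.ncard_le_card _

/-- The common lower bounds of `u, v` and of `v, w` are initial segments of the chain below `v`.
Hence one contains the other, and the smaller consists of common lower bounds of `u` and `w`. -/
theorem min_commonCount_le (hc : ∀ a b c : V, a ≤ c → b ≤ c → a ≤ b ∨ b ≤ a) (u v w : V) :
    min (commonCount u v) (commonCount v w) ≤ commonCount u w := by
  by_cases h : {a | a ≤ u ∧ a ≤ v} ⊆ {a | a ≤ v ∧ a ≤ w}
  · exact (min_le_left _ _).trans
      (Set.ncard_le_ncard (fun a ha => ⟨ha.1, (h ha).2⟩) (Set.toFinite _))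
  · refine (min_le_right _ _).trans
      (Set.ncard_le_ncard (fun a ha => ⟨?_, ha.2⟩) (Set.toFinite _))
    obtain ⟨b, hb, hb'⟩ := Set.not_subset.1 h
    rcases hc a b v ha.1 hb.2 with h' | h'
    · exact h'.trans hb.1
    · exact absurd ⟨hb.2, h'.trans ha.2⟩ hb'

theorem ncard_Iic_le_commonCount_iff (hc : ∀ a b c : V, a ≤ c → b ≤ c → a ≤ b ∨ b ≤ a)
    {u v : V} (hv : v ≤ u) (w : V) : (Set.Iic v).ncard ≤ commonCount u w ↔ v ≤ w := by
  constructor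
  · intro h
    by_contra hvw
    refine absurd h (not_le.2 (Set.ncard_lt_ncard ?_ (Set.toFinite _)))
    refine (Set.ssubset_iff_of_subset fun a ha => ?_).2 ⟨v, Set.mem_Iic.2 le_rfl, fun h => hvw h.2⟩
    exact (hc a v u ha.1 hv).resolve_right fun h' => hvw (h'.trans ha.2)
  · intro h
    exact Set.ncard_le_ncard (fun a ha => ⟨le_trans ha hv, le_trans ha h⟩) (Set.toFinite _)

variable {X : Type*} (p : X → V)

open Classical in
/-- The ultrametric on `X` in which distinct points are the closer, the more common lower bounds
their images in the finite order `V` have. -/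
noncomputable abbrev commonCountMetric (hc : ∀ a b c : V, a ≤ c → b ≤ c → a ≤ b ∨ b ≤ a) : MetricSpace X where
  -- The `+ 1` keeps distinct points apart even if their vertices have all of `V` as common lower
  -- bounds.
  dist x y := if x = y then 0 else (Fintype.card V + 1 - commonCount (p x) (p y) : ℝ)
  dist_self x := if_pos rfl
  dist_comm x y := by simp only [eq_comm, commonCount_comm]
  dist_triangle x y z := by
    have hle : ∀ a b : V, (commonCount a b : ℝ) ≤ Fintype.card V := fun a b =>
      mod_cast commonCount_le a b
    have h1 := hle (p x) (p y)
    have h2 := hle (p y) (p z)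
    have h3 : min (commonCount (p x) (p y) : ℝ) (commonCount (p y) (p z)) ≤
        commonCount (p x) (p z) := mod_cast min_commonCount_le hc (p x) (p y) (p z)
    by_cases hxy : x = y
    · simp [hxy]
    by_cases hyz : y = z
    · simp [hyz]
    rw [if_neg hxy, if_neg hyz]
    split_ifs
    · linarith
    · rcases min_le_iff.1 h3 with h | h <;> linarith
  eq_of_dist_eq_zero := by
    intro x y h
    by_contra hne
    have h1 : (commonCount (p x) (p y) : ℝ) ≤ Fintype.card V := mod_cast commonCount_le _ _
    rw [if_neg hne] at h
    linarith

variable (hc : ∀ a b c : V, a ≤ c → b ≤ c → a ≤ b ∨ b ≤ a)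

theorem commonCountMetric_dist {x y : X} (h : x ≠ y) :
    (commonCountMetric p hc).dist x y = Fintype.card V + 1 - commonCount (p x) (p y) :=
  if_neg h

theorem commonCountMetric_isUltrametricDist :
    letI := commonCountMetric p hc; IsUltrametricDist X := by
  let := commonCountMetric p hc
  refine ⟨fun x y z => ?_⟩
  by_cases hxz : x = z
  · rw [hxz, dist_self]
    exact le_max_of_le_left dist_nonneg
  by_cases hxy : x = y
  · rw [hxy]
    exact le_max_right _ _
  by_cases hyz : y = z
  · rw [hyz]
    exact le_max_left _ _
  have h3 : min (commonCount (p x) (p y) : ℝ) (commonCount (p y) (p z)) ≤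
      commonCount (p x) (p z) := mod_cast min_commonCount_le hc (p x) (p y) (p z)
  rw [commonCountMetric_dist p hc hxy, commonCountMetric_dist p hc hyz,
    commonCountMetric_dist p hc hxz, le_max_iff]
  exact (min_le_iff.1 h3).imp (fun h => by linarith) (fun h => by linarith)

variable {p hc}

/-- The points above `v` form a closed ball about each of them, with radius determined by the depth
of `v`. -/
theorem commonCountMetric_dist_le_iff {x : X} {v : V} (hv : v ≤ p x) (y : X) :
    (commonCountMetric p hc).dist x y ≤ Fintype.card V + 1 - (Set.Iic v).ncard ↔ v ≤ p y := by
  by_cases h : x = y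
  · subst h
    refine iff_of_true ?_ hv
    have : ((Set.Iic v).ncard : ℝ) ≤ Fintype.card V := by
      rw [← Nat.card_eq_fintype_card]
      exact mod_cast Set.ncard_le_card _
    rw [(commonCountMetric p hc).dist_self]
    linarith
  · rw [commonCountMetric_dist p hc h, ← ncard_Iic_le_commonCount_iff hc hv, sub_le_sub_iff_left,
      Nat.cast_le]

/-- A maximal vertex above `v` has no children, so the fibre condition puts points there. -/
theorem exists_le_apply [Finite X] (hp : ∀ u, 2 ≤ (p ⁻¹' {u}).ncard + {w | u ⋖ w}.ncard) (v : V) :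
    ∃ x, v ≤ p x := by
  obtain ⟨u, hvu, hu⟩ := (Set.toFinite (Set.univ : Set V)).exists_le_maximal (Set.mem_univ v)
  have h0 : {w | u ⋖ w} = ∅ :=
    Set.eq_empty_iff_forall_notMem.2 fun w hw => hw.lt.not_ge (hu.2 trivial hw.le)
  have h := hp u
  rw [h0, Set.ncard_empty] at h
  obtain ⟨x, hx⟩ := Set.nonempty_of_ncard_ne_zero (s := p ⁻¹' {u}) (by omega)
  exact ⟨x, hvu.trans (show p x = u from hx).ge⟩

include hc in
/-- Every vertex is the meet of the images of two distinct points. -/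
theorem exists_ne_forall_le_iff [Finite X]
    (hp : ∀ u, 2 ≤ (p ⁻¹' {u}).ncard + {w | u ⋖ w}.ncard) (v : V) :
    ∃ x y, x ≠ y ∧ ∀ a, a ≤ p x ∧ a ≤ p y ↔ a ≤ v := by
  -- Choose two distinct objects among the points over `v` and the children of `v`, and replace each
  -- child by a point above it. Points above different children of `v` have exactly the lower bounds
  -- of `v` in common.
  have hcard : 1 < (Sum.inl '' (p ⁻¹' {v}) ∪ Sum.inr '' {w | v ⋖ w} : Set (X ⊕ V)).ncard := by
    rw [Set.ncard_union_eq, Set.ncard_image_of_injective _ Sum.inl_injective,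
      Set.ncard_image_of_injective _ Sum.inr_injective]
    · exact hp v
    · rw [Set.disjoint_left]
      rintro _ ⟨x, -, rfl⟩ ⟨w, -, h⟩
      exact Sum.inr_ne_inl h
  have hmixed : ∀ x w, p x = v → v ⋖ w → ∃ y, x ≠ y ∧ ∀ a, a ≤ p x ∧ a ≤ p y ↔ a ≤ v := by
    intro x w hx hw
    obtain ⟨y, hy⟩ := exists_le_apply hp w
    refine ⟨y, ?_, fun a => ?_⟩
    · rintro rfl
      exact hw.lt.not_ge (hx ▸ hy)
    · rw [hx]
      exact and_iff_left_of_imp fun h => h.trans (hw.le.trans hy)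
  obtain ⟨s, t, hs, ht, hst⟩ := (Set.one_lt_ncard_iff (Set.toFinite _)).1 hcard
  rcases hs with ⟨x, hx, rfl⟩ | ⟨w, hw, rfl⟩ <;> rcases ht with ⟨y, hy, rfl⟩ | ⟨z, hz, rfl⟩
  · refine ⟨x, y, fun h => hst (by rw [h]), fun a => ?_⟩
    rw [show p x = v from hx, show p y = v from hy, and_self]
  · exact ⟨x, hmixed x z hx hz⟩
  · exact ⟨y, hmixed y w hy hw⟩
  · have hwz : ¬ w ≤ z ∧ ¬ z ≤ w := by
      have hne : w ≠ z := fun h => hst (by rw [h])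
      constructor <;> intro h
      · rcases hz.eq_or_eq hw.le h with h' | h'
        · exact hw.ne' h'
        · exact hne h'
      · rcases hw.eq_or_eq hz.le h with h' | h'
        · exact hz.ne' h'
        · exact hne h'.symm
    obtain ⟨x, hx⟩ := exists_le_apply hp w
    obtain ⟨y, hy⟩ := exists_le_apply hp z
    refine ⟨x, y, ?_, fun a => ⟨fun ⟨hax, hay⟩ => ?_, fun h => ?_⟩⟩
    · rintro rfl
      exact (hc w z _ hx hy).elim hwz.1 hwz.2
    · have haw : a ≤ w := (hc a w _ hax hx).resolve_right fun h =>
        (hc w z _ (h.trans hay) hy).elim hwz.1 hwz.2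
      have haz : a ≤ z := (hc a z _ hay hy).resolve_right fun h =>
        (hc w z _ hx (h.trans hax)).elim hwz.1 hwz.2
      rcases hc a v w haw hw.le with h | h
      · exact h
      rcases hw.eq_or_eq h haw with rfl | rfl
      · exact le_rfl
      · exact absurd haz hwz.1
    · exact ⟨h.trans (hw.le.trans hx), h.trans (hz.le.trans hy)⟩

/-- The vertex `v` corresponds to the set of points above it. For surjectivity, two points realising
the diameter of a node determine `v` as the greatest common lower bound of their vertices; it exists
because `r` is a common lower bound and lower bounds form chains. -/
theorem exists_equiv_internalNodes [Finite X]
    (hp : ∀ u, 2 ≤ (p ⁻¹' {u}).ncard + {w | u ⋖ w}.ncard) (r : V) (hr : ∀ a, r ≤ a) :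
    letI := commonCountMetric p hc
    ∃ f : V ≃ internalNodes X, ∀ u v, v ≤ u ↔ (f u).1.1 ⊆ (f v).1.1 := by
  let := commonCountMetric p hc
  have := commonCountMetric_isUltrametricDist p hc
  have hball : ∀ v, IsRepresentingNode {x | v ≤ p x} := by
    intro v
    refine isRepresentingNode_of_forall_mem (exists_le_apply hp v) fun x hx y hy =>
      (commonCountMetric_dist_le_iff hx y).1 (hy.trans ?_)
    obtain ⟨z, hz, hxz⟩ := exists_dist_eq_diam hx
    rw [← hxz]
    exact (commonCountMetric_dist_le_iff hx z).2 hz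
  have hpos : ∀ v, 0 < Metric.diam {x | v ≤ p x} := by
    intro v
    obtain ⟨x, y, hne, h⟩ := exists_ne_forall_le_iff (hc := hc) hp v
    exact diam_pos_of_nontrivial ⟨x, ((h v).2 le_rfl).1, y, ((h v).2 le_rfl).2, hne⟩
  have hle : ∀ u v, v ≤ u ↔ {x | u ≤ p x} ⊆ {x | v ≤ p x} := by
    intro u v
    constructor
    · exact fun h x hx => h.trans hx
    · intro h
      obtain ⟨x, y, -, hxy⟩ := exists_ne_forall_le_iff (hc := hc) hp u
      have hu := (hxy u).2 le_rfl
      exact (hxy v).1 ⟨h hu.1, h hu.2⟩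
  let F : V → internalNodes X := fun v => ⟨⟨{x | v ≤ p x}, hball v⟩, hpos v⟩
  have hF : Function.Bijective F := by
    constructor
    · intro u v h
      have h' : {x | u ≤ p x} = {x | v ≤ p x} := congrArg (fun A : internalNodes X => A.1.1) h
      exact le_antisymm ((hle v u).2 h'.ge) ((hle u v).2 h'.le)
    · rintro ⟨⟨A, hA⟩, hApos⟩
      change 0 < Metric.diam A at hApos
      obtain ⟨x, hx⟩ := (nontrivial_of_diam_pos hApos).nonempty
      obtain ⟨y, hy, hxy⟩ := exists_dist_eq_diam hx
      have hne : x ≠ y := by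
        rintro rfl
        rw [dist_self] at hxy
        exact hApos.ne hxy
      obtain ⟨v, hv, hmax⟩ :=
        (Set.toFinite {a | a ≤ p x ∧ a ≤ p y}).exists_maximal ⟨r, hr _, hr _⟩
      have hIic : {a | a ≤ p x ∧ a ≤ p y} = Set.Iic v := by
        ext a
        refine ⟨fun ha => ?_, fun ha => ⟨le_trans ha hv.1, le_trans ha hv.2⟩⟩
        rcases hc a v _ ha.1 hv.1 with h | h
        · exact h
        · exact hmax ha h
      have hdiam : Metric.diam A = Fintype.card V + 1 - (Set.Iic v).ncard := by
        rw [← hxy, ← hIic]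
        exact commonCountMetric_dist p hc hne
      refine ⟨v, Subtype.ext (Subtype.ext ?_)⟩
      ext z
      change v ≤ p z ↔ z ∈ A
      rw [← commonCountMetric_dist_le_iff (hc := hc) hv.1 z, ← hdiam]
      exact ⟨fun h => hA.mem_of_dist_le hx h, fun h => dist_le_diam_of_finite hx h⟩
  exact ⟨Equiv.ofBijective F hF, hle⟩

/-- Each point over `r` is a colour class of its own; the others are coloured by the child of `r`
below them. Differently coloured points have only `r` as common lower bound, hence are at the
largest possible distance. -/
theorem commonCountMetric_hasHamiltonCycle [Finite X] (r : V) (hr : ∀ a, r ≤ a)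
    (h3 : 3 ≤ Nat.card X) (hhalf : ∀ w, r ⋖ w → 2 * {x | w ≤ p x}.ncard ≤ Nat.card X) :
    letI := commonCountMetric p hc; HasHamiltonCycle (diametricalGraph X) := by
  let := commonCountMetric p hc
  -- the colour of a point is its part in the diametrical graph
  have hcol : ∀ x, ∃ c : X ⊕ V, (p x = r ∧ c = Sum.inl x) ∨
      ∃ w, r ⋖ w ∧ w ≤ p x ∧ c = Sum.inr w := by
    intro x
    by_cases hx : p x = r
    · exact ⟨_, Or.inl ⟨hx, rfl⟩⟩
    · obtain ⟨w, hw, hwx⟩ := exists_covBy_le_of_lt (lt_of_le_of_ne (hr (p x)) (Ne.symm hx))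
      exact ⟨_, Or.inr ⟨w, hw, hwx, rfl⟩⟩
  choose col hcol using hcol
  have hunique : ∀ x w, r ⋖ w → w ≤ p x → col x = Sum.inr w := by
    intro x w hw hwx
    rcases hcol x with ⟨hx, -⟩ | ⟨z, hz, hzx, h⟩
    · exact absurd (hx ▸ hwx) hw.lt.not_ge
    · rw [h]
      rcases hc w z _ hwx hzx with h' | h'
      · rcases hz.eq_or_eq hw.le h' with h'' | h''
        · exact absurd h'' hw.ne'
        · rw [h'']
      · rcases hw.eq_or_eq hz.le h' with h'' | h''
        · exact absurd h'' hz.ne'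
        · rw [h'']
  refine hasHamiltonCycle_of_coloring _ h3 col (fun x y hxy => ?_) ?_
  · have hne : x ≠ y := fun h => hxy (by rw [h])
    have hone : {a | a ≤ p x ∧ a ≤ p y} = {r} := by
      refine Set.eq_singleton_iff_unique_mem.2 ⟨⟨hr _, hr _⟩, fun a ha => ?_⟩
      by_contra har
      obtain ⟨w, hw, hwa⟩ := exists_covBy_le_of_lt (lt_of_le_of_ne (hr a) (Ne.symm har))
      exact hxy ((hunique x w hw (hwa.trans ha.1)).trans
        (hunique y w hw (hwa.trans ha.2)).symm)
    have hdist : dist x y = Fintype.card V := by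
      rw [commonCountMetric_dist p hc hne, commonCount, hone, Set.ncard_singleton]
      simp
    refine ⟨hne, le_antisymm (dist_le_diam_of_finite trivial trivial) ?_⟩
    rw [hdist]
    refine Metric.diam_le_of_forall_dist_le (Nat.cast_nonneg _) fun a _ b _ => ?_
    by_cases hab : a = b
    · rw [hab, dist_self]
      exact Nat.cast_nonneg _
    · rw [commonCountMetric_dist p hc hab]
      have : 1 ≤ commonCount (p a) (p b) :=
        (Set.ncard_pos (Set.toFinite _)).2 ⟨r, hr _, hr _⟩
      have : (1 : ℝ) ≤ commonCount (p a) (p b) := mod_cast this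
      linarith
  · rintro (x | w)
    · have hsub : {y | col y = Sum.inl x} ⊆ {x} := by
        intro y hy
        rcases hcol y with ⟨-, h⟩ | ⟨w, -, -, h⟩
        · exact Sum.inl_injective (h.symm.trans hy)
        · exact absurd (h.symm.trans hy) Sum.inr_ne_inl
      have := Set.ncard_le_ncard hsub
      rw [Set.ncard_singleton] at this
      omega
    · by_cases hw : r ⋖ w
      · refine le_trans ?_ (hhalf w hw)
        refine Nat.mul_le_mul_left 2 (Set.ncard_le_ncard (fun y hy => ?_) (Set.toFinite _))
        rcases hcol y with ⟨-, h⟩ | ⟨z, -, hz, h⟩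
        · exact absurd (h.symm.trans hy) Sum.inl_ne_inr
        · rw [← Sum.inr_injective (h.symm.trans hy)]
          exact hz
      · have : {y | col y = Sum.inr w} = ∅ := by
          refine Set.eq_empty_iff_forall_notMem.2 fun y hy => ?_
          rcases hcol y with ⟨-, h⟩ | ⟨z, hz, -, h⟩
          · exact Sum.inl_ne_inr (h.symm.trans hy)
          · exact hw (Sum.inr_injective (h.symm.trans hy) ▸ hz)
        rw [this, Set.ncard_empty]
        exact Nat.zero_le _

end Construction

/-- Maps to a finite type with prescribed sizes of the fibres. -/
theorem exists_map_ncard_preimage_eq {V : Type*} [Fintype V] (c : V → ℕ) :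
    ∃ p : Fin (∑ u, c u) → V, ∀ s : Finset V, (p ⁻¹' s).ncard = ∑ u ∈ s, c u := by
  have hcard : Fintype.card (Σ u : V, Fin (c u)) = ∑ u, c u := by simp
  let e : (Σ u : V, Fin (c u)) ≃ Fin (∑ u, c u) := Fintype.equivFinOfCardEq hcard
  refine ⟨fun i => (e.symm i).1, fun s => ?_⟩
  have h : (fun i => (e.symm i).1) ⁻¹' (s : Set V) =
      e '' ((s.sigma fun _ => Finset.univ : Finset (Σ u : V, Fin (c u))) : Set _) := by
    ext i
    obtain ⟨j, rfl⟩ := e.surjective i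
    simp
  rw [h, Set.ncard_image_of_injective _ e.injective, Set.ncard_coe_finset, Finset.card_sigma]
  simp

/-! ### The minimal number of points -/

namespace RTree

variable {V : Type*} (T : RTree V)

theorem outDegree_eq (u : V) : T.outDegree u = (letI := T.partialOrder; {w | u ⋖ w}.ncard) := by
  let := T.partialOrder
  exact congrArg Set.ncard (Set.ext fun w => mem_children_iff)

variable [Fintype V]

open Classical in
theorem subtreeSum_eq (v : V) :
    T.subtreeSum v = ∑ u ∈ Finset.univ.filter (T.Anc v), (2 - T.outDegree u) := by
  simp only [subtreeSum, mem_subtreeVerts_iff]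

/-- A maximal vertex above `v` has no children and contributes `2`. -/
theorem two_le_subtreeSum (v : V) : 2 ≤ T.subtreeSum v := by
  classical
  let := T.partialOrder
  obtain ⟨u, hvu, hu⟩ := (Set.toFinite (Set.univ : Set V)).exists_le_maximal (Set.mem_univ v)
  have h0 : T.outDegree u = 0 := by
    rw [outDegree_eq, Set.ncard_eq_zero]
    exact Set.eq_empty_iff_forall_notMem.2 fun w hw => hw.lt.not_ge (hu.2 trivial hw.le)
  rw [subtreeSum_eq]
  refine le_trans (by rw [h0]) (Finset.single_le_sum (f := fun u => 2 - T.outDegree u)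
    (fun _ _ => Nat.zero_le _) (Finset.mem_filter.2 ⟨Finset.mem_univ u, hvu⟩))

/-- A finite ultrametric space with hamiltonian diametrical graph and internal tree `T` that has `N`
points, where all surplus points are attached to the root. -/
theorem exists_hamiltonian_space {N : ℕ}
    (hsum : T.totalSum ≤ N + (2 - T.outDegree T.root))
    (hroot : T.totalSum + 2 ≤ N + (2 - T.outDegree T.root) + T.outDegree T.root)
    (hhalf : ∀ w ∈ T.children T.root, 2 * T.subtreeSum w ≤ N) (hN : 3 ≤ N) :
    ∃ (X : Type) (_ : MetricSpace X) (_ : IsUltrametricDist X) (_ : Finite X),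
      T.IsoInternalTree X ∧ HasHamiltonCycle (diametricalGraph X) ∧ Nat.card X = N := by
  classical
  let := T.partialOrder
  let R := ∑ u ∈ ({T.root} : Finset V)ᶜ, (2 - T.outDegree u)
  have hR : R + (2 - T.outDegree T.root) = T.totalSum := by
    rw [totalSum, ← Finset.sum_compl_add_sum {T.root}, Finset.sum_singleton]
  -- `R` is the demand of the other vertices. In terms of it, `hsum` says `R ≤ N`, and `hroot` says
  -- that the `N - R` points left for the root, together with its children, number at least two.
  let c : V → ℕ := fun u => if u = T.root then N - R else 2 - T.outDegree u
  have hcroot : c T.root = N - R := if_pos rfl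
  have hcne : ∀ u, u ≠ T.root → c u = 2 - T.outDegree u := fun u hu => if_neg hu
  have hcR : ∑ u ∈ ({T.root} : Finset V)ᶜ, c u = R := by
    refine Finset.sum_congr rfl fun u hu => hcne u ?_
    simpa using hu
  have hcsum : ∑ u, c u = N := by
    rw [← Finset.sum_compl_add_sum {T.root}, hcR, Finset.sum_singleton, hcroot]
    omega
  obtain ⟨p, hp⟩ : ∃ p : Fin N → V, ∀ s : Finset V, (p ⁻¹' s).ncard = ∑ u ∈ s, c u :=
    hcsum ▸ exists_map_ncard_preimage_eq c
  have hfib : ∀ u, 2 ≤ (p ⁻¹' {u}).ncard + {w | u ⋖ w}.ncard := by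
    intro u
    have h := hp {u}
    rw [Finset.coe_singleton, Finset.sum_singleton] at h
    rw [h, ← outDegree_eq]
    by_cases hu : u = T.root
    · rw [hu, hcroot]
      omega
    · rw [hcne u hu]
      omega
  have hchain : ∀ a b c : V, a ≤ c → b ≤ c → a ≤ b ∨ b ≤ a := fun _ _ _ => Anc.total
  have hpart : ∀ w, T.root ⋖ w → 2 * {x | w ≤ p x}.ncard ≤ Nat.card (Fin N) := by
    intro w hw
    have h := hp (Finset.univ.filter (T.Anc w))
    have hset : p ⁻¹' (Finset.univ.filter (T.Anc w) : Finset V) = {x | w ≤ p x} := by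
      ext x
      simp only [Finset.coe_filter, Finset.mem_univ, true_and]
      rfl
    rw [hset] at h
    rw [h, Nat.card_fin]
    refine le_trans (le_of_eq ?_) (hhalf w (mem_children_iff.2 hw))
    rw [subtreeSum_eq]
    congr 1
    refine Finset.sum_congr rfl fun u hu => hcne u ?_
    rintro rfl
    exact hw.lt.not_ge (Finset.mem_filter.1 hu).2
  let := commonCountMetric p hchain
  refine ⟨Fin N, this, commonCountMetric_isUltrametricDist p hchain, inferInstance, ?_, ?_, ?_⟩
  · have := commonCountMetric_isUltrametricDist p hchain
    exact T.isoInternalTree_iff.2 (exists_equiv_internalNodes hfib T.root root_anc)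
  · exact commonCountMetric_hasHamiltonCycle T.root root_anc (by rwa [Nat.card_fin]) hpart
  · exact Nat.card_fin N

/-- The node of a child of the root is a proper subset of the space, so its diameter is smaller and
it is independent in the diametrical graph. -/
theorem le_card_of_isoInternalTree {Y : Type*} [MetricSpace Y] [IsUltrametricDist Y] [Finite Y]
    (hT : T.IsoInternalTree Y) (hY : HasHamiltonCycle (diametricalGraph Y)) :
    T.totalSum ≤ Nat.card Y ∧ ∀ w ∈ T.children T.root, 2 * T.subtreeSum w ≤ Nat.card Y := by
  classical
  let := T.partialOrder
  obtain ⟨f, hf⟩ := T.isoInternalTree_iff.1 hT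
  refine ⟨?_, fun w hw => ?_⟩
  · have := sum_two_sub_ncard_le_ncard hf Finset.univ Set.univ fun u _ => Set.subset_univ _
    simpa only [totalSum, Set.ncard_univ, ← outDegree_eq] using this
  · have hsum := sum_two_sub_ncard_le_ncard hf (Finset.univ.filter (T.Anc w)) (f w).1.1
      fun u hu => (hf u w).1 (Finset.mem_filter.1 hu).2
    simp only [← outDegree_eq] at hsum
    rw [← subtreeSum_eq] at hsum
    refine (Nat.mul_le_mul_left 2 hsum).trans (hY.two_mul_ncard_le _ fun x hx y hy hxy => ?_)
    have hssub : (f w).1.1 ⊂ Set.univ := by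
      refine Set.ssubset_univ_iff.2 fun h => ?_
      have : T.Anc w T.root := (hf T.root w).2 (h ▸ Set.subset_univ _)
      exact (mem_children_iff.1 hw).lt.not_ge this
    have hlt := (f w).1.2.diam_lt hssub ⟨x, hx⟩
    exact (hxy.2 ▸ dist_le_diam_of_finite hx hy).not_gt hlt

end RTree

theorem theorem4p4 {V : Type*} [Fintype V] (T : RTree V)
    (k : ℕ) (hk : 1 ≤ k) (v : Fin k → V) (hv : Function.Injective v)
    (hchildren : Set.range v = T.children T.root) :
    (∃ (X : Type) (_ : MetricSpace X) (_ : IsUltrametricDist X) (_ : Finite X),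
      T.IsoInternalTree X ∧
      HasHamiltonCycle (diametricalGraph X) ∧
      Nat.card X =
        if k = 1 then 2 * T.subtreeSum (v ⟨0, hk⟩)
        else T.totalSum +
          (2 * (Finset.univ.sup fun i => T.subtreeSum (v i)) - T.totalSum)) ∧
    (∀ (Y : Type*) [MetricSpace Y] [IsUltrametricDist Y] [Finite Y],
      T.IsoInternalTree Y →
      HasHamiltonCycle (diametricalGraph Y) →
      Nat.card Y ≥
        if k = 1 then 2 * T.subtreeSum (v ⟨0, hk⟩)
        else T.totalSum +
          (2 * (Finset.univ.sup fun i => T.subtreeSum (v i)) - T.totalSum)) := by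
  classical
  let := T.partialOrder
  have hmem : ∀ i, v i ∈ T.children T.root := fun i => hchildren ▸ Set.mem_range_self i
  have hdeg : T.outDegree T.root = k := by
    rw [RTree.outDegree, ← hchildren, ← Set.image_univ, Set.ncard_image_of_injective _ hv,
      Set.ncard_univ, Nat.card_fin]
  have hsup : ∀ i, T.subtreeSum (v i) ≤ Finset.univ.sup fun i => T.subtreeSum (v i) :=
    fun i => Finset.le_sup (f := fun i => T.subtreeSum (v i)) (Finset.mem_univ i)
  have htwo := T.two_le_subtreeSum (v ⟨0, hk⟩)
  -- A root with one child contributes exactly `1`, and every other vertex lies in the subtree of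
  -- that child.
  have hone : k = 1 → T.totalSum = T.subtreeSum (v ⟨0, hk⟩) + 1 := by
    intro hk1
    subst hk1
    rw [RTree.totalSum, ← Finset.sum_compl_add_sum {T.root}, Finset.sum_singleton, hdeg,
      RTree.subtreeSum_eq]
    congr 1
    refine Finset.sum_congr (Finset.ext fun u => ?_) fun _ _ => rfl
    simp only [Finset.mem_compl, Finset.mem_singleton, Finset.mem_filter, Finset.mem_univ,
      true_and]
    constructor
    · intro hu
      obtain ⟨w, hw, hwu⟩ :=
        exists_covBy_le_of_lt (lt_of_le_of_ne (RTree.root_anc u) (Ne.symm hu))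
      obtain ⟨i, hi⟩ : w ∈ Set.range v := hchildren ▸ RTree.mem_children_iff.2 hw
      rw [Subsingleton.elim i ⟨0, hk⟩] at hi
      exact hi ▸ hwu
    · rintro hu rfl
      exact (RTree.mem_children_iff.1 (hmem ⟨0, hk⟩)).lt.not_ge hu
  constructor
  · have h0 := hsup ⟨0, hk⟩
    refine T.exists_hamiltonian_space ?_ ?_ ?_ ?_
    · rw [hdeg]
      split_ifs with hk1
      · have := hone hk1
        omega
      · omega
    · rw [hdeg]
      split_ifs with hk1
      · have := hone hk1
        omega
      · omega
    · intro w hw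
      obtain ⟨i, rfl⟩ : w ∈ Set.range v := hchildren ▸ hw
      split_ifs with hk1
      · subst hk1
        rw [Subsingleton.elim i ⟨0, hk⟩]
      · have := hsup i
        omega
    · split_ifs <;> omega
  · intro Y _ _ _ hT hY
    obtain ⟨h1, h2⟩ := T.le_card_of_isoInternalTree hT hY
    split_ifs
    · exact h2 _ (hmem _)
    · have : (Finset.univ.sup fun i => T.subtreeSum (v i)) ≤ Nat.card Y / 2 :=
        Finset.sup_le fun i _ => by
          have := h2 _ (hmem i)
          omega
      omega
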